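/- Let $\mathcal H$ be a complex Hilbert space and let $\rho=\sum_k\lambda_k|\phi_k\rangle\langle\phi_k|$ be a quantum state on $\mathcal H$, where $(\phi_k)$ is an orthonormal family, $\lambda_k\ge 0$ and $\sum_k\lambda_k=1$. Let $X,Y$ be observables, i.e. (possibly unbounded) self-adjoint operators on $\mathcal H$, such that $$[X,Y]=XY-YX=\frac{1}{2\pi i}I\quad\text{on }\mathrm{dom}(XY)\cap\mathrm{dom}(YX),$$ and suppose that every $\phi_k$ lies in $\mathrm{dom}(XY)\cap\mathrm{dom}(YX)$. For $\alpha\in[0,1]$ and $T\in\{X,Y\}$ put $A=\tfrac12(\rho^{\alpha}+\rho^{1-\alpha})$ (with $\rho^0=I$), $T_0=T-\mathrm{Tr}[\rho T]I$, and $$K_{\rho,\alpha}(T)=\tfrac12\mathrm{Tr}\big[(i[A,T_0])^2\big],\qquad L_{\rho,\alpha}(T)=\tfrac12\mathrm{Tr}\big[\{A,T_0\}^2\big],\qquad W_{\rho,\alpha}(T)=\sqrt{K_{\rho,\alpha}(T)\,L_{\rho,\alpha}(T)},$$ where $[\cdot,\cdot]$ is the commutator and $\{\cdot,\cdot\}$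 the anticommutator. Here $\mathrm{Tr}[\rho Z]=\sum_k\lambda_k\langle\phi_k,Z\phi_k\rangle$ for a possibly unbounded $Z$ whose domain contains every $\phi_k$; and for $S=i[A,T_0]$ or $S=\{A,T_0\}$, understood as a sesquilinear form $s(x,y)=\langle x,Sy\rangle$ on $\mathrm{dom}(T)$ (that is, $s(x,y)=i(\langle Ax,T_0y\rangle-\langle T_0x,Ay\rangle)$, respectively $s(x,y)=\langle Ax,T_0y\rangle+\langle T_0x,Ay\rangle$), $\mathrm{Tr}[S^2]\in[0,\infty]$ is the squared Hilbert–Schmidt norm of $S$, i.e. the supremum of $\sum_{i,j}|s(e_i,e_j)|^2$ over finite orthonormal families $(e_i)$ in $\mathrm{dom}(T)$. Then, for every $\alpha\in[0,1]$, as an inequality in $[0,\infty]$, $$W_{\rho,\alpha}(X)\,W_{\rho,\alpha}(Y)\ \ge\ \tfrac14\big|\mathrm{Tr}[\rho[X,Y]]\big|^2 .$$ -/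

import Mathlib

open scoped ENNReal InnerProductSpace

noncomputable section

namespace SkewInformation

variable {H : Type*} [NormedAddCommGroup H] [InnerProductSpace ℂ H]

/-- The product `S T` of two partially defined operators, with its natural domain
`{x ∈ dom T | T x ∈ dom S}`. -/
def opMul (S T : H →ₗ.[ℂ] H) : H →ₗ.[ℂ] H where
  domain :=
    { carrier := {x | ∃ h : x ∈ T.domain, T ⟨x, h⟩ ∈ S.domain}
      zero_mem' := ⟨T.domain.zero_mem, by
        have h : T ⟨0, T.domain.zero_mem⟩ = 0 := T.map_zero
        rw [h]; exact S.domain.zero_mem⟩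
      add_mem' := by
        rintro x y ⟨hx, hx'⟩ ⟨hy, hy'⟩
        refine ⟨T.domain.add_mem hx hy, ?_⟩
        have h : T ⟨x + y, T.domain.add_mem hx hy⟩ = T ⟨x, hx⟩ + T ⟨y, hy⟩ :=
          T.map_add ⟨x, hx⟩ ⟨y, hy⟩
        rw [h]; exact S.domain.add_mem hx' hy'
      smul_mem' := by
        rintro c x ⟨hx, hx'⟩
        refine ⟨T.domain.smul_mem c hx, ?_⟩
        have h : T ⟨c • x, T.domain.smul_mem c hx⟩ = c • T ⟨x, hx⟩ := T.map_smul c ⟨x, hx⟩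
        rw [h]; exact S.domain.smul_mem c hx' }
  toFun :=
    { toFun := fun x => S ⟨T ⟨x.1, x.2.1⟩, x.2.2⟩
      map_add' := fun x y => by
        rw [← S.map_add]
        exact congrArg S (Subtype.ext (T.map_add ⟨x.1, x.2.1⟩ ⟨y.1, y.2.1⟩))
      map_smul' := fun c x => by
        rw [RingHom.id_apply, ← S.map_smul]
        exact congrArg S (Subtype.ext (T.map_smul c ⟨x.1, x.2.1⟩)) }

/-- The commutator `[X, Y] = X Y - Y X`; its domain is `dom (X Y) ∩ dom (Y X)`. -/
def commutator (X Y : H →ₗ.[ℂ] H) : H →ₗ.[ℂ] H := opMul X Y - opMul Y X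

theorem mem_domain_left {X Y : H →ₗ.[ℂ] H} {x : H} (h : x ∈ (commutator X Y).domain) :
    x ∈ X.domain := h.2.1

theorem mem_domain_right {X Y : H →ₗ.[ℂ] H} {x : H} (h : x ∈ (commutator X Y).domain) :
    x ∈ Y.domain := h.1.1

/-- A spectral decomposition `ρ = ∑ k, λ k • |φ k⟩⟨φ k|` of a quantum state `ρ`: the `φ k` are
orthonormal, `λ k ≥ 0` and `∑ k, λ k = 1`. The `φ k` may, but need not, span the kernel of `ρ`. -/
structure SpectralDecomposition (ι : Type*) (ρ : H →L[ℂ] H) where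
  /-- the eigenvalues `λ k` -/
  eigenvalue : ι → ℝ
  /-- the eigenvectors `φ k` -/
  eigenvector : ι → H
  orthonormal : Orthonormal ℂ eigenvector
  nonneg : ∀ k, 0 ≤ eigenvalue k
  hasSum_one : HasSum eigenvalue 1
  hasSum_op : HasSum
    (fun k => (eigenvalue k : ℂ) • InnerProductSpace.rankOne ℂ (eigenvector k) (eigenvector k)) ρ

/-- `Tr[ρ T] = ∑ k, λ k ⟨φ k, T φ k⟩` for a possibly unbounded `T` whose domain contains
every `φ k`. -/
def traceWith {ι : Type*} {ρ : H →L[ℂ] H} (D : SpectralDecomposition ι ρ) (T : H →ₗ.[ℂ] H)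
    (hT : ∀ k, D.eigenvector k ∈ T.domain) : ℂ :=
  ∑' k, (D.eigenvalue k : ℂ) * ⟪D.eigenvector k, T ⟨D.eigenvector k, hT k⟩⟫_ℂ

/-- `T₀ = T - Tr[ρ T] I`, with the same domain as `T`. Where the series for `Tr[ρ T]` does not
converge absolutely, the value of the sum is irrelevant: `L_{ρ,α}(T)` below is then `∞` whatever
multiple of `I` is subtracted, and `K_{ρ,α}(T)` never depends on that multiple. -/
def centered {ι : Type*} {ρ : H →L[ℂ] H} (D : SpectralDecomposition ι ρ) (T : H →ₗ.[ℂ] H)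
    (hT : ∀ k, D.eigenvector k ∈ T.domain) : H →ₗ.[ℂ] H :=
  (-(traceWith D T hT • (LinearMap.id : H →ₗ[ℂ] H))) +ᵥ T

/-- The sesquilinear form `⟨x, i[A, T] y⟩` of `i[A, T] = i(A T - T A)` on `dom T`, for a bounded
self-adjoint `A` and a self-adjoint `T`. -/
def commForm (A : H →L[ℂ] H) (T : H →ₗ.[ℂ] H) (x y : T.domain) : ℂ :=
  Complex.I * (⟪A x, T y⟫_ℂ - ⟪T x, A y⟫_ℂ)

/-- The sesquilinear form `⟨x, {A, T} y⟩` of `{A, T} = A T + T A` on `dom T`, for a bounded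
self-adjoint `A` and a self-adjoint `T`. -/
def anticommForm (A : H →L[ℂ] H) (T : H →ₗ.[ℂ] H) (x y : T.domain) : ℂ :=
  ⟪A x, T y⟫_ℂ + ⟪T x, A y⟫_ℂ

/-- `Tr[S²] ∈ [0, ∞]` for a symmetric operator `S` that is given by its sesquilinear form
`q x y = ⟨x, S y⟩` on a dense subspace `V`: the supremum of `∑ i j, |⟨e i, S (e j)⟩|²` over the
finite orthonormal families in `V`. It is the squared Hilbert-Schmidt norm of `S`, and `∞` if `S`
does not extend to a Hilbert-Schmidt operator. -/
def traceSq {V : Submodule ℂ H} (q : V → V → ℂ) : ℝ≥0∞ :=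
  ⨆ (n : ℕ) (e : Fin n → V) (_ : Orthonormal ℂ (fun i => (e i : H))),
    ∑ i, ∑ j, ‖q (e i) (e j)‖ₑ ^ 2

variable [CompleteSpace H]

/-- The mean `(ρ ^ α + ρ ^ (1 - α)) / 2`, with the powers of the functional calculus
(so that `ρ ^ 0 = I`). -/
def powerMean (ρ : H →L[ℂ] H) (α : ℝ) : H →L[ℂ] H :=
  (2⁻¹ : ℂ) • (ρ ^ α + ρ ^ (1 - α))

/-- `K_{ρ,α}(T) = ½ Tr[(i[(ρ ^ α + ρ ^ (1 - α)) / 2, T₀])²]`. -/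
def skewK {ι : Type*} {ρ : H →L[ℂ] H} (D : SpectralDecomposition ι ρ) (α : ℝ) (T : H →ₗ.[ℂ] H)
    (hT : ∀ k, D.eigenvector k ∈ T.domain) : ℝ≥0∞ :=
  2⁻¹ * traceSq (commForm (powerMean ρ α) (centered D T hT))

/-- `L_{ρ,α}(T) = ½ Tr[{(ρ ^ α + ρ ^ (1 - α)) / 2, T₀}²]`. -/
def skewL {ι : Type*} {ρ : H →L[ℂ] H} (D : SpectralDecomposition ι ρ) (α : ℝ) (T : H →ₗ.[ℂ] H)
    (hT : ∀ k, D.eigenvector k ∈ T.domain) : ℝ≥0∞ :=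
  2⁻¹ * traceSq (anticommForm (powerMean ρ α) (centered D T hT))

/-- `W_{ρ,α}(T) = √(K_{ρ,α}(T) L_{ρ,α}(T))`. -/
def skewW {ι : Type*} {ρ : H →L[ℂ] H} (D : SpectralDecomposition ι ρ) (α : ℝ) (T : H →ₗ.[ℂ] H)
    (hT : ∀ k, D.eigenvector k ∈ T.domain) : ℝ≥0∞ :=
  (skewK D α T hT * skewL D α T hT) ^ (1 / 2 : ℝ)

end SkewInformation

end

/-! Work with the mean `A = (ρ ^ α + ρ ^ (1 - α)) / 2`, which has the eigenvectors `φ k` of `ρ` and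
eigenvalues `a k` with `λ k ≤ a k ^ 2` by AM-GM. In an orthonormal family starting with the `φ k`,
the form of `i[A, X]` has moduli `|a j - a k| |⟪X φ j, φ k⟫|` and that of `{A, Y}` has moduli
`(a j + a k) |⟪Y φ j, φ k⟫|`. Cauchy-Schwarz pairs these into the weights `a j ^ 2 - a k ^ 2`, and
since `Im (⟪X φ j, φ k⟫ ⟪φ k, Y φ j⟫)` is antisymmetric in `j, k`, the sum of the products collapses
to `2 ∑ k, a k ^ 2 Im ⟪X φ k, Y φ k⟫`, where `2 Im ⟪X φ k, Y φ k⟫` has the modulus of the scalar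
`[X, Y]`.

Only finitely many vectors can be handled at once, so `a k` is replaced by `max (a k - ε) 0`, where
`ε` dominates `A` on the complement of the family, and `ε` tends to the value at the kernel of `ρ`.
For `0 < α < 1` that value is `0` and nothing is lost. For `α ∈ {0, 1}` it is `1/2`, and one only
learns that no factor vanishes; but there `A ≥ 1/2`, so finiteness of `L(X)` and `L(Y)` would make
`X` and `Y` bounded. The commutator of bounded operators is never a nonzero scalar (Wielandt), so
the product is `∞`.
-/

namespace SkewInformation

section Residual

variable {H : Type*} [NormedAddCommGroup H] [InnerProductSpace ℂ H] {κ : Type*} [Fintype κ]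

/-- The projection onto the orthogonal complement of a finite orthonormal family `φ`. -/
noncomputable def residual (φ : κ → H) : H →L[ℂ] H :=
  ContinuousLinearMap.id ℂ H - ∑ k, InnerProductSpace.rankOne ℂ (φ k) (φ k)

theorem residual_apply (φ : κ → H) (w : H) : residual φ w = w - ∑ k, ⟪φ k, w⟫_ℂ • φ k := by
  simp [residual]

theorem inner_residual_right {φ : κ → H} (hφ : Orthonormal ℂ φ) (k : κ) (w : H) :
    ⟪φ k, residual φ w⟫_ℂ = 0 := by
  rw [residual_apply, inner_sub_right, hφ.inner_right_fintype, sub_self]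

theorem inner_eq_sum_add_inner_residual {φ : κ → H} (hφ : Orthonormal ℂ φ) (u v : H) :
    ⟪u, v⟫_ℂ = ∑ k, ⟪u, φ k⟫_ℂ * ⟪φ k, v⟫_ℂ + ⟪residual φ u, residual φ v⟫_ℂ := by
  rw [residual_apply φ u, inner_sub_left, sum_inner]
  simp only [inner_smul_left, inner_residual_right hφ, mul_zero, Finset.sum_const_zero, sub_zero]
  simp only [residual_apply, inner_sub_right, inner_sum, inner_smul_right, mul_comm,
    add_sub_cancel]

theorem norm_sq_eq_sum_add_norm_residual_sq {φ : κ → H} (hφ : Orthonormal ℂ φ) (v : H) :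
    ‖v‖ ^ 2 = ∑ k, ‖⟪v, φ k⟫_ℂ‖ ^ 2 + ‖residual φ v‖ ^ 2 := by
  have h := inner_eq_sum_add_inner_residual hφ v v
  simp only [inner_self_eq_norm_sq_to_K, ← inner_conj_symm (φ _) v, RCLike.mul_conj] at h
  exact_mod_cast h

theorem map_residual {φ : κ → H} {A : H →L[ℂ] H} (hA : A.IsSymmetric)
    {a : κ → ℝ} (ha : ∀ k, A (φ k) = (a k : ℂ) • φ k) (w : H) :
    A (residual φ w) = residual φ (A w) := by
  have hinner (k : κ) : ⟪φ k, A w⟫_ℂ = a k * ⟪φ k, w⟫_ℂ := by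
    rw [← hA.apply_clm, ha, inner_smul_left, Complex.conj_ofReal]
  simp only [residual_apply, map_sub, map_sum, map_smul, ha, hinner, smul_smul, mul_comm]

end Residual

section TraceSq

variable {H : Type*} [NormedAddCommGroup H] [InnerProductSpace ℂ H] {κ : Type*} [Fintype κ]
  {V : Submodule ℂ H}

theorem sum_norm_sq_le_traceSq (q : V → V → ℂ) {e : κ → V} (he : Orthonormal ℂ fun i => (e i : H)) :
    ENNReal.ofReal (∑ i, ∑ j, ‖q (e i) (e j)‖ ^ 2) ≤ traceSq q := by
  let σ := (Fintype.equivFin κ).symm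
  have hσ : Orthonormal ℂ fun i => (e (σ i) : H) := he.comp σ σ.injective
  calc ENNReal.ofReal (∑ i, ∑ j, ‖q (e i) (e j)‖ ^ 2)
    _ = ∑ i, ∑ j, ‖q (e i) (e j)‖ₑ ^ 2 := by
        simp only [ENNReal.ofReal_sum_of_nonneg, Finset.sum_nonneg, sq_nonneg, implies_true,
          ENNReal.ofReal_pow, norm_nonneg, ofReal_norm]
    _ = ∑ i, ∑ j, ‖q (e (σ i)) (e (σ j))‖ₑ ^ 2 := by
        rw [← Equiv.sum_comp σ]
        exact Finset.sum_congr rfl fun i _ => (Equiv.sum_comp σ _).symm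
    _ ≤ traceSq q := le_iSup₂_of_le (Fintype.card κ) (fun i => e (σ i)) (le_iSup_of_le hσ le_rfl)

theorem exists_orthonormalBasis_extending {G : Type*} [NormedAddCommGroup G]
    [InnerProductSpace ℂ G] [FiniteDimensional ℂ G] {φ : κ → G} (hφ : Orthonormal ℂ φ) :
    ∃ (n : ℕ) (b : OrthonormalBasis (κ ⊕ Fin n) ℂ G), ∀ k, b (Sum.inl k) = φ k := by
  have hcard : Fintype.card κ ≤ Module.finrank ℂ G := hφ.linearIndependent.fintype_card_le_finrank
  have hv : Orthonormal ℂ ((Set.range Sum.inl).domRestrict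
      (Sum.elim φ (0 : Fin (Module.finrank ℂ G - Fintype.card κ) → G))) := by
    refine ⟨?_, ?_⟩
    · rintro ⟨_, k, rfl⟩
      exact hφ.1 k
    · rintro ⟨_, k, rfl⟩ ⟨_, l, rfl⟩ hkl
      exact hφ.2 fun h => hkl (by rw [h])
  obtain ⟨b, hb⟩ := hv.exists_orthonormalBasis_extension_of_card_eq (by simp [hcard])
  exact ⟨_, b, fun k => hb _ ⟨k, rfl⟩⟩

theorem two_mul_sum_sub_sum_le_traceSq {q : V → V → ℂ} (hq : ∀ x y, ‖q y x‖ = ‖q x y‖)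
    {φ : κ → V} (hφ : Orthonormal ℂ fun k => (φ k : H)) {g : κ → H}
    (hg : ∀ j y, ‖q (φ j) y‖ = ‖⟪g j, (y : H)⟫_ℂ‖)
    {G : Submodule ℂ H} [FiniteDimensional ℂ G] (hGV : G ≤ V) (hφG : ∀ k, (φ k : H) ∈ G) :
    ENNReal.ofReal (2 * ∑ j, ‖G.starProjection (g j)‖ ^ 2 -
      ∑ j, ∑ k, ‖⟪g j, (φ k : H)⟫_ℂ‖ ^ 2) ≤ traceSq q := by
  obtain ⟨n, b, hb⟩ := exists_orthonormalBasis_extending (φ := fun k => (⟨φ k, hφG k⟩ : G))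
    ⟨hφ.1, hφ.2⟩
  let e : κ ⊕ Fin n → V := fun i => ⟨b i, hGV (b i).2⟩
  have he : Orthonormal ℂ fun i => (e i : H) := b.orthonormal.comp_linearIsometry G.subtypeₗᵢ
  have heφ (k : κ) : e (Sum.inl k) = φ k := Subtype.ext (by simp only [e, hb])
  have hparseval (j : κ) : ‖G.starProjection (g j)‖ ^ 2 =
      ∑ k, ‖⟪g j, (φ k : H)⟫_ℂ‖ ^ 2 + ∑ m, ‖⟪g j, (e (Sum.inr m) : H)⟫_ℂ‖ ^ 2 := by
    rw [Submodule.starProjection_apply, ← Submodule.coe_norm, ← b.sum_sq_norm_inner_left]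
    simp only [Fintype.sum_sum_type, Submodule.inner_orthogonalProjectionOnto_eq_of_mem_right, hb,
      e]
  -- Rows and columns at the `φ j` each give `∑ j, ‖P (g j)‖ ^ 2`; their overlap counts once.
  refine le_trans (ENNReal.ofReal_le_ofReal ?_) (sum_norm_sq_le_traceSq q he)
  have hcorner : 0 ≤ ∑ m, ∑ m', ‖q (e (Sum.inr m)) (e (Sum.inr m'))‖ ^ 2 := by positivity
  simp only [Fintype.sum_sum_type, heφ, hq (φ _), hg, hparseval, Finset.sum_add_distrib]
    at hcorner ⊢
  rw [Finset.sum_comm (s := (Finset.univ : Finset κ)) (t := (Finset.univ : Finset κ))]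
  rw [Finset.sum_comm (s := (Finset.univ : Finset (Fin n)))]
  linarith

theorem sum_add_residual_le_traceSq (hV : Dense (V : Set H)) {q : V → V → ℂ}
    (hq : ∀ x y, ‖q y x‖ = ‖q x y‖) {φ : κ → V} (hφ : Orthonormal ℂ fun k => (φ k : H))
    {g : κ → H} (hg : ∀ j y, ‖q (φ j) y‖ = ‖⟪g j, (y : H)⟫_ℂ‖) :
    ENNReal.ofReal (∑ j, ∑ k, ‖⟪g j, (φ k : H)⟫_ℂ‖ ^ 2 +
      2 * ∑ j, ‖residual (fun k => (φ k : H)) (g j)‖ ^ 2) ≤ traceSq q := by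
  classical
  let G (s : Finset V) : Submodule ℂ H := Submodule.span ℂ ((↑) '' (s : Set V))
  have hGV (s : Finset V) : G s ≤ V := Submodule.span_le.2 (by rintro _ ⟨v, -, rfl⟩; exact v.2)
  have hfin (s : Finset V) : FiniteDimensional ℂ (G s) :=
    FiniteDimensional.span_of_finite ℂ (s.finite_toSet.image _)
  have hmono : Monotone G := fun s t hst => Submodule.span_mono (Set.image_mono hst)
  have hdense : ⊤ ≤ (⨆ s, G s).topologicalClosure := by
    have hVG : V ≤ ⨆ s, G s := fun v hv =>
      Submodule.mem_iSup_of_mem {⟨v, hv⟩} (Submodule.subset_span (by simp))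
    rw [top_le_iff, ← Submodule.dense_iff_topologicalClosure_eq_top]
    exact hV.mono hVG
  have hproj (w : H) : Filter.Tendsto (fun s => (G s).starProjection w) Filter.atTop (nhds w) :=
    Submodule.starProjection_tendsto_self G hmono w hdense
  have hlim : Filter.Tendsto (fun s => ENNReal.ofReal (2 * ∑ j, ‖(G s).starProjection (g j)‖ ^ 2 -
      ∑ j, ∑ k, ‖⟪g j, (φ k : H)⟫_ℂ‖ ^ 2)) Filter.atTop (nhds (ENNReal.ofReal
      (2 * ∑ j, ‖g j‖ ^ 2 - ∑ j, ∑ k, ‖⟪g j, (φ k : H)⟫_ℂ‖ ^ 2))) :=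
    ENNReal.tendsto_ofReal (((tendsto_finsetSum _ fun j _ =>
      (hproj (g j)).norm.pow 2).const_mul 2).sub_const _)
  have hnorm : 2 * ∑ j, ‖g j‖ ^ 2 - ∑ j, ∑ k, ‖⟪g j, (φ k : H)⟫_ℂ‖ ^ 2 =
      ∑ j, ∑ k, ‖⟪g j, (φ k : H)⟫_ℂ‖ ^ 2 +
        2 * ∑ j, ‖residual (fun k => (φ k : H)) (g j)‖ ^ 2 := by
    simp only [norm_sq_eq_sum_add_norm_residual_sq hφ (g _), Finset.sum_add_distrib]
    ring
  rw [← hnorm]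
  refine le_of_tendsto hlim ?_
  filter_upwards [Filter.eventually_ge_atTop (Finset.univ.image φ)] with s hs
  exact two_mul_sum_sub_sum_le_traceSq hq hφ hg (hGV s) fun k =>
    Submodule.subset_span ⟨φ k, hs (Finset.mem_image_of_mem φ (Finset.mem_univ k)), rfl⟩

end TraceSq

section Bounded

variable {H : Type*} [NormedAddCommGroup H] [InnerProductSpace ℂ H] {V : Submodule ℂ H}

theorem norm_apply_le_sqrt_traceSq (q : V →ₗ⋆[ℂ] V →ₗ[ℂ] ℂ)
    (hq : traceSq (fun x y => q x y) ≠ ⊤) (x y : V) :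
    ‖q x y‖ ≤ √(traceSq fun x y => q x y).toReal * ‖x‖ * ‖y‖ := by
  let G : Submodule ℂ V := Submodule.span ℂ {x, y}
  have : FiniteDimensional ℂ G := FiniteDimensional.span_of_finite ℂ (Set.toFinite _)
  let b := stdOrthonormalBasis ℂ G
  have hx : x ∈ G := Submodule.subset_span (by simp)
  have hy : y ∈ G := Submodule.subset_span (by simp)
  have hexpand {z : V} (hz : z ∈ G) : ∑ i, ⟪b i, (⟨z, hz⟩ : G)⟫_ℂ • (b i : V) = z := by
    simpa using congrArg Subtype.val (b.sum_repr' ⟨z, hz⟩)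
  have hparseval {z : V} (hz : z ∈ G) : ∑ i, ‖⟪b i, (⟨z, hz⟩ : G)⟫_ℂ‖ ^ 2 = ‖z‖ ^ 2 :=
    b.sum_sq_norm_inner_right ⟨z, hz⟩
  have htraceSq : ∑ i, ∑ j, ‖q (b i) (b j)‖ ^ 2 ≤ (traceSq fun x y => q x y).toReal :=
    (ENNReal.ofReal_le_iff_le_toReal hq).1 <| sum_norm_sq_le_traceSq (fun x y => q x y)
      ((b.orthonormal.comp_linearIsometry G.subtypeₗᵢ).comp_linearIsometry V.subtypeₗᵢ)
  have hsum : ‖q x y‖ ≤ ∑ p : _ × _, ‖⟪b p.1, (⟨x, hx⟩ : G)⟫_ℂ‖ * ‖⟪b p.2, (⟨y, hy⟩ : G)⟫_ℂ‖ *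
      ‖q (b p.1) (b p.2)‖ := by
    conv_lhs => rw [← hexpand hx, ← hexpand hy]
    simp only [map_sum, LinearMap.sum_apply, map_smulₛₗ, LinearMap.smul_apply, smul_eq_mul,
      RingHom.id_apply, Finset.mul_sum]
    rw [Finset.sum_comm, ← Fintype.sum_prod_type']
    refine (norm_sum_le _ _).trans_eq (Finset.sum_congr rfl fun p _ => ?_)
    simp only [norm_mul, RCLike.norm_conj]
    ring
  have hsq : ‖q x y‖ ^ 2 ≤ (√(traceSq fun x y => q x y).toReal * ‖x‖ * ‖y‖) ^ 2 := by
    calc ‖q x y‖ ^ 2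
      _ ≤ (∑ p : _ × _, (‖⟪b p.1, (⟨x, hx⟩ : G)⟫_ℂ‖ * ‖⟪b p.2, (⟨y, hy⟩ : G)⟫_ℂ‖) ^ 2) *
          ∑ p : _ × _, ‖q (b p.1) (b p.2)‖ ^ 2 := by
        refine (pow_le_pow_left₀ (norm_nonneg _) hsum 2).trans ?_
        exact Finset.sum_mul_sq_le_sq_mul_sq _ _ _
      _ = ‖x‖ ^ 2 * ‖y‖ ^ 2 * ∑ i, ∑ j, ‖q (b i) (b j)‖ ^ 2 := by
        simp only [Fintype.sum_prod_type, mul_pow, ← Finset.mul_sum, ← Finset.sum_mul, hparseval]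
      _ ≤ ‖x‖ ^ 2 * ‖y‖ ^ 2 * (traceSq fun x y => q x y).toReal := by gcongr
      _ = _ := by
        rw [mul_pow, mul_pow, Real.sq_sqrt ENNReal.toReal_nonneg]
        ring
  exact le_of_sq_le_sq hsq (by positivity)

end Bounded

section Forms

variable {H : Type*} [NormedAddCommGroup H] [InnerProductSpace ℂ H]

theorem norm_commForm_comm (A : H →L[ℂ] H) (T : H →ₗ.[ℂ] H) (x y : T.domain) :
    ‖commForm A T y x‖ = ‖commForm A T x y‖ := by
  have h : commForm A T y x = (starRingEnd ℂ) (commForm A T x y) := by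
    simp only [commForm, map_mul, map_sub, inner_conj_symm, Complex.conj_I]
    ring
  rw [h, RCLike.norm_conj]

theorem norm_anticommForm_comm (A : H →L[ℂ] H) (T : H →ₗ.[ℂ] H) (x y : T.domain) :
    ‖anticommForm A T y x‖ = ‖anticommForm A T x y‖ := by
  have h : anticommForm A T y x = (starRingEnd ℂ) (anticommForm A T x y) := by
    simp only [anticommForm, map_add, inner_conj_symm]
    ring
  rw [h, RCLike.norm_conj]

variable {A : H →L[ℂ] H} {T : H →ₗ.[ℂ] H}

theorem commForm_eigenvector (hA : A.IsSymmetric) (hT : T.IsFormalAdjoint T) {x : T.domain}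
    {a : ℝ} (hx : A x = (a : ℂ) • (x : H)) (y : T.domain) :
    commForm A T x y = Complex.I * ⟪(a : ℂ) • T x + (-A) (T x), (y : H)⟫_ℂ := by
  simp only [commForm, hx, neg_apply, inner_add_left, inner_neg_left, inner_smul_left,
    Complex.conj_ofReal, hT x y, hA.apply_clm, sub_eq_add_neg]

theorem anticommForm_eigenvector (hA : A.IsSymmetric) (hT : T.IsFormalAdjoint T) {x : T.domain}
    {a : ℝ} (hx : A x = (a : ℂ) • (x : H)) (y : T.domain) :
    anticommForm A T x y = ⟪(a : ℂ) • T x + A (T x), (y : H)⟫_ℂ := by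
  simp only [anticommForm, hx, inner_add_left, inner_smul_left, Complex.conj_ofReal, hT x y,
    hA.apply_clm]

end Forms

section RowBounds

variable {H : Type*} [NormedAddCommGroup H] [InnerProductSpace ℂ H] {κ : Type*} [Fintype κ]

theorem sum_mul_sq_le_traceSq {V : Submodule ℂ H} (hV : Dense (V : Set H)) {q : V → V → ℂ}
    (hq : ∀ x y, ‖q y x‖ = ‖q x y‖) {φ : κ → V} (hφ : Orthonormal ℂ fun k => (φ k : H))
    {B : H →L[ℂ] H} (hB : B.IsSymmetric) {c : κ → ℝ} (hc : ∀ k, B (φ k) = (c k : ℂ) • (φ k : H))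
    {a : κ → ℝ} {v : κ → H}
    (hrow : ∀ j y, ‖q (φ j) y‖ = ‖⟪(a j : ℂ) • v j + B (v j), (y : H)⟫_ℂ‖)
    {d : κ → κ → ℝ} (hd : ∀ j k, |d j k| ≤ |a j + c k|) {b : κ → ℝ}
    (hb : ∀ j w, (∀ k, ⟪(φ k : H), w⟫_ℂ = 0) → |b j| * ‖w‖ ≤ ‖(a j : ℂ) • w + B w‖) :
    ENNReal.ofReal (∑ j, ∑ k, (d j k * ‖⟪v j, (φ k : H)⟫_ℂ‖) ^ 2 +
      2 * ∑ j, (b j * ‖residual (fun k => (φ k : H)) (v j)‖) ^ 2) ≤ traceSq q := by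
  refine le_trans (ENNReal.ofReal_le_ofReal ?_) (sum_add_residual_le_traceSq hV hq hφ hrow)
  gcongr ∑ j, ∑ k, ?_ + 2 * ∑ j, ?_ with j _ k _ j _
  · have hentry : ⟪(a j : ℂ) • v j + B (v j), (φ k : H)⟫_ℂ =
        ((a j + c k : ℝ) : ℂ) * ⟪v j, (φ k : H)⟫_ℂ := by
      rw [inner_add_left, hB.apply_clm, hc, inner_smul_left, inner_smul_right, Complex.conj_ofReal]
      push_cast
      ring
    rw [hentry, norm_mul, Complex.norm_real, Real.norm_eq_abs, mul_pow, mul_pow, sq_abs]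
    exact mul_le_mul_of_nonneg_right (sq_le_sq.2 (hd j k)) (sq_nonneg _)
  · rw [map_add, map_smul, ← map_residual hB hc, mul_pow, ← sq_abs (b j), ← mul_pow]
    gcongr
    exact hb j _ fun k => inner_residual_right hφ k (v j)

theorem abs_max_sub_mul_norm_le {u w : H} {a ε : ℝ} (hu : ‖u‖ ≤ ε * ‖w‖) :
    |max (a - ε) 0| * ‖w‖ ≤ ‖(a : ℂ) • w + u‖ := by
  rw [abs_of_nonneg (le_max_right _ _), max_mul_of_nonneg _ _ (norm_nonneg w), zero_mul]
  refine max_le ?_ (norm_nonneg _)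
  calc (a - ε) * ‖w‖ ≤ |a| * ‖w‖ - ‖u‖ := by
        linarith [mul_le_mul_of_nonneg_right (le_abs_self a) (norm_nonneg w)]
    _ = ‖(a : ℂ) • w‖ - ‖u‖ := by rw [norm_smul, Complex.norm_real, Real.norm_eq_abs]
    _ ≤ ‖(a : ℂ) • w + u‖ := norm_sub_le_norm_add _ _

variable {A : H →L[ℂ] H} {T : H →ₗ.[ℂ] H} {φ : κ → T.domain} {a : κ → ℝ} {ε : ℝ}

theorem sum_mul_sq_le_traceSq_commForm (hA : A.IsSymmetric) (hT : T.IsFormalAdjoint T)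
    (hdT : Dense (T.domain : Set H)) (hφ : Orthonormal ℂ fun k => (φ k : H))
    (ha : ∀ k, A (φ k) = (a k : ℂ) • (φ k : H))
    (hε : ∀ w, (∀ k, ⟪(φ k : H), w⟫_ℂ = 0) → ‖A w‖ ≤ ε * ‖w‖) :
    ENNReal.ofReal
      (∑ j, ∑ k, ((max (a j - ε) 0 - max (a k - ε) 0) * ‖⟪T (φ j), (φ k : H)⟫_ℂ‖) ^ 2 +
        2 * ∑ j, (max (a j - ε) 0 * ‖residual (fun k => (φ k : H)) (T (φ j))‖) ^ 2) ≤
      traceSq (commForm A T) := by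
  refine sum_mul_sq_le_traceSq hdT (norm_commForm_comm A T) hφ (B := -A) (c := fun k => -a k)
    (fun x y => by simpa using hA x y) (fun k => by simp [ha]) (a := a)
    (v := fun j => T (φ j)) (fun j y => ?_) (fun j k => ?_) (fun j w hw => ?_)
  · rw [commForm_eigenvector hA hT (ha j), norm_mul, Complex.norm_I, one_mul]
  · calc _ ≤ |(a j - ε) - (a k - ε)| := abs_max_sub_max_le_abs _ _ _
      _ = _ := by ring_nf
  · exact abs_max_sub_mul_norm_le (by simpa using hε w hw)

theorem sum_mul_sq_le_traceSq_anticommForm (hA : A.IsSymmetric) (hT : T.IsFormalAdjoint T)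
    (hdT : Dense (T.domain : Set H)) (hφ : Orthonormal ℂ fun k => (φ k : H))
    (ha : ∀ k, A (φ k) = (a k : ℂ) • (φ k : H)) (ha0 : ∀ k, 0 ≤ a k) (hε0 : 0 ≤ ε)
    (hε : ∀ w, (∀ k, ⟪(φ k : H), w⟫_ℂ = 0) → ‖A w‖ ≤ ε * ‖w‖) :
    ENNReal.ofReal
      (∑ j, ∑ k, ((max (a j - ε) 0 + max (a k - ε) 0) * ‖⟪T (φ j), (φ k : H)⟫_ℂ‖) ^ 2 +
        2 * ∑ j, (max (a j - ε) 0 * ‖residual (fun k => (φ k : H)) (T (φ j))‖) ^ 2) ≤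
      traceSq (anticommForm A T) := by
  have hmax (k : κ) : max (a k - ε) 0 ≤ a k := max_le (by linarith) (ha0 k)
  refine sum_mul_sq_le_traceSq hdT (norm_anticommForm_comm A T) hφ hA ha (a := a)
    (v := fun j => T (φ j)) (fun j y => ?_) (fun j k => ?_) (fun j w hw => ?_)
  · rw [anticommForm_eigenvector hA hT (ha j)]
  · exact abs_le_abs_of_nonneg (by positivity) (add_le_add (hmax j) (hmax k))
  · exact abs_max_sub_mul_norm_le (hε w hw)

end RowBounds

section FiniteUncertainty

variable {H : Type*} [NormedAddCommGroup H] [InnerProductSpace ℂ H] {κ : Type*} [Fintype κ]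

theorem sq_im_inner_le {E : Type*} [NormedAddCommGroup E] [InnerProductSpace ℂ E] (u v : E) :
    (⟪u, v⟫_ℂ).im ^ 2 ≤ (‖u‖ * ‖v‖) ^ 2 :=
  sq_le_sq.2 (((Complex.abs_im_le_norm _).trans (norm_inner_le_norm _ _)).trans (le_abs_self _))

theorem two_mul_sum_sq_mul_im_inner {φ : κ → H} (hφ : Orthonormal ℂ φ) {x y : κ → H}
    (hx : ∀ j k, ⟪x j, φ k⟫_ℂ = ⟪φ j, x k⟫_ℂ) (hy : ∀ j k, ⟪y j, φ k⟫_ℂ = ⟪φ j, y k⟫_ℂ)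
    (b : κ → ℝ) :
    2 * ∑ j, b j ^ 2 * (⟪x j, y j⟫_ℂ).im =
      ∑ j, ∑ k, (b j ^ 2 - b k ^ 2) * (⟪x j, φ k⟫_ℂ * ⟪φ k, y j⟫_ℂ).im +
        2 * ∑ j, b j ^ 2 * (⟪residual φ (x j), residual φ (y j)⟫_ℂ).im := by
  have hanti (j k : κ) :
      (⟪x k, φ j⟫_ℂ * ⟪φ j, y k⟫_ℂ).im = -(⟪x j, φ k⟫_ℂ * ⟪φ k, y j⟫_ℂ).im := by
    rw [hx k j, ← hy j k, ← inner_conj_symm (φ k) (x j), ← inner_conj_symm (y j) (φ k), ← map_mul,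
      Complex.conj_im]
  have hswap : ∑ j, ∑ k, b k ^ 2 * (⟪x j, φ k⟫_ℂ * ⟪φ k, y j⟫_ℂ).im =
      -∑ j, ∑ k, b j ^ 2 * (⟪x j, φ k⟫_ℂ * ⟪φ k, y j⟫_ℂ).im := by
    rw [Finset.sum_comm]
    simp only [← Finset.sum_neg_distrib, ← mul_neg, ← hanti]
  simp only [inner_eq_sum_add_inner_residual hφ (x _) (y _), Complex.add_im, Complex.im_sum,
    sub_mul, Finset.sum_sub_distrib, hswap, mul_add, Finset.sum_add_distrib, Finset.mul_sum]
  simp only [two_mul, Finset.sum_add_distrib]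
  ring

theorem sq_two_mul_sum_sq_mul_im_inner_le {φ : κ → H} (hφ : Orthonormal ℂ φ) {x y : κ → H}
    (hx : ∀ j k, ⟪x j, φ k⟫_ℂ = ⟪φ j, x k⟫_ℂ) (hy : ∀ j k, ⟪y j, φ k⟫_ℂ = ⟪φ j, y k⟫_ℂ)
    (b : κ → ℝ) :
    (2 * ∑ j, b j ^ 2 * (⟪x j, y j⟫_ℂ).im) ^ 2 ≤
      (∑ j, ∑ k, ((b j - b k) * ‖⟪x j, φ k⟫_ℂ‖) ^ 2 +
          2 * ∑ j, (b j * ‖residual φ (x j)‖) ^ 2) *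
        (∑ j, ∑ k, ((b j + b k) * ‖⟪y j, φ k⟫_ℂ‖) ^ 2 +
          2 * ∑ j, (b j * ‖residual φ (y j)‖) ^ 2) := by
  have hblock (j k : κ) : ((b j ^ 2 - b k ^ 2) * (⟪x j, φ k⟫_ℂ * ⟪φ k, y j⟫_ℂ).im) ^ 2 ≤
      ((b j - b k) * ‖⟪x j, φ k⟫_ℂ‖) ^ 2 * ((b j + b k) * ‖⟪y j, φ k⟫_ℂ‖) ^ 2 := by
    calc _ = ((b j - b k) * (b j + b k)) ^ 2 * (⟪x j, φ k⟫_ℂ * ⟪φ k, y j⟫_ℂ).im ^ 2 := by ring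
      _ ≤ ((b j - b k) * (b j + b k)) ^ 2 * (‖⟪x j, φ k⟫_ℂ‖ * ‖⟪φ k, y j⟫_ℂ‖) ^ 2 := by
        refine mul_le_mul_of_nonneg_left ?_ (sq_nonneg _)
        have h := sq_im_inner_le ⟪φ k, x j⟫_ℂ ⟪φ k, y j⟫_ℂ
        rwa [RCLike.inner_apply, inner_conj_symm, mul_comm, norm_inner_symm (φ k) (x j)] at h
      _ = _ := by
        rw [norm_inner_symm (φ k)]
        ring
  have hrest (j : κ) : (2 * (b j ^ 2 * (⟪residual φ (x j), residual φ (y j)⟫_ℂ).im)) ^ 2 ≤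
      2 * (b j * ‖residual φ (x j)‖) ^ 2 * (2 * (b j * ‖residual φ (y j)‖) ^ 2) := by
    calc _ = 4 * b j ^ 4 * (⟪residual φ (x j), residual φ (y j)⟫_ℂ).im ^ 2 := by ring
      _ ≤ 4 * b j ^ 4 * (‖residual φ (x j)‖ * ‖residual φ (y j)‖) ^ 2 :=
        mul_le_mul_of_nonneg_left (sq_im_inner_le _ _) (by positivity)
      _ = _ := by ring
  let f : (κ × κ) ⊕ κ → ℝ := Sum.elim (fun p => ((b p.1 - b p.2) * ‖⟪x p.1, φ p.2⟫_ℂ‖) ^ 2)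
    fun j => 2 * (b j * ‖residual φ (x j)‖) ^ 2
  let g : (κ × κ) ⊕ κ → ℝ := Sum.elim (fun p => ((b p.1 + b p.2) * ‖⟪y p.1, φ p.2⟫_ℂ‖) ^ 2)
    fun j => 2 * (b j * ‖residual φ (y j)‖) ^ 2
  have hcs := Finset.sum_sq_le_sum_mul_sum_of_sq_le_mul Finset.univ
    (r := Sum.elim (fun p => _) fun j => _) (f := f) (g := g)
    (by rintro (p | j) - <;> simp only [f, Sum.elim_inl, Sum.elim_inr] <;> positivity)
    (by rintro (p | j) - <;> simp only [g, Sum.elim_inl, Sum.elim_inr] <;> positivity)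
    (fun i _ => Sum.rec (fun p => hblock p.1 p.2) hrest i)
  rw [two_mul_sum_sq_mul_im_inner hφ hx hy]
  simpa only [Fintype.sum_sum_type, Sum.elim_inl, Sum.elim_inr, Fintype.sum_prod_type,
    Finset.mul_sum, f, g] using hcs

theorem sq_two_mul_sum_im_inner_le_traceSq_mul_traceSq {A : H →L[ℂ] H} (hA : A.IsSymmetric)
    {X Y : H →ₗ.[ℂ] H} (hX : X.IsFormalAdjoint X) (hdX : Dense (X.domain : Set H))
    (hY : Y.IsFormalAdjoint Y) (hdY : Dense (Y.domain : Set H)) {φ : κ → H} (hφ : Orthonormal ℂ φ)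
    (hφX : ∀ k, φ k ∈ X.domain) (hφY : ∀ k, φ k ∈ Y.domain) {a : κ → ℝ}
    (ha : ∀ k, A (φ k) = (a k : ℂ) • φ k) (ha0 : ∀ k, 0 ≤ a k) {ε : ℝ} (hε0 : 0 ≤ ε)
    (hε : ∀ w, (∀ k, ⟪φ k, w⟫_ℂ = 0) → ‖A w‖ ≤ ε * ‖w‖) :
    ENNReal.ofReal
      ((2 * ∑ k, max (a k - ε) 0 ^ 2 * (⟪X ⟨φ k, hφX k⟩, Y ⟨φ k, hφY k⟩⟫_ℂ).im) ^ 2) ≤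
      traceSq (commForm A X) * traceSq (anticommForm A Y) := by
  have hcomm := sum_mul_sq_le_traceSq_commForm (φ := fun k => ⟨φ k, hφX k⟩) hA hX hdX hφ ha hε
  have hanti := sum_mul_sq_le_traceSq_anticommForm (φ := fun k => ⟨φ k, hφY k⟩) hA hY hdY hφ ha
    ha0 hε0 hε
  refine le_trans ?_ (mul_le_mul' hcomm hanti)
  rw [← ENNReal.ofReal_mul (by positivity)]
  exact ENNReal.ofReal_le_ofReal <| sq_two_mul_sum_sq_mul_im_inner_le hφ
    (fun j k => hX ⟨φ j, hφX j⟩ ⟨φ k, hφX k⟩) (fun j k => hY ⟨φ j, hφY j⟩ ⟨φ k, hφY k⟩) _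

end FiniteUncertainty

section FunctionalCalculus

variable {H : Type*} [NormedAddCommGroup H] [InnerProductSpace ℂ H]

theorem real_mem_spectrum_of_apply_eq_smul {a : H →L[ℂ] H} {v : H} {μ : ℝ} (hv : v ≠ 0)
    (h : a v = (μ : ℂ) • v) : μ ∈ spectrum ℝ a := by
  rintro ⟨u, hu⟩
  have huv : (u : H →L[ℂ] H) v = 0 := by
    rw [hu, sub_apply, h, Algebra.algebraMap_eq_smul_one]
    simp
  have huu : ((↑u⁻¹ : H →L[ℂ] H) * (u : H →L[ℂ] H)) v = v := by simp
  rw [mul_apply_eq_comp, huv, map_zero] at huu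
  exact hv huu.symm

variable [CompleteSpace H] {a : H →L[ℂ] H} {v : H} {μ : ℝ}

theorem cfc_apply_of_apply_eq_smul (ha : IsSelfAdjoint a) {f : ℝ → ℝ}
    (hf : ContinuousOn f (spectrum ℝ a)) (h : a v = (μ : ℂ) • v) :
    cfc f a v = (f μ : ℂ) • v := by
  rcases eq_or_ne v 0 with rfl | hv
  · simp
  have hμ := real_mem_spectrum_of_apply_eq_smul hv h
  suffices ∀ g : C(spectrum ℝ a, ℝ), (cfcHom (a := a) ha g : H →L[ℂ] H) v = (g ⟨μ, hμ⟩ : ℂ) • v by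
    rw [cfc_apply f a ha hf]
    exact this _
  intro g
  induction g using ContinuousMap.induction_on_of_compact with
  | const r =>
    have hr : ContinuousMap.const (spectrum ℝ a) r = algebraMap ℝ C(spectrum ℝ a, ℝ) r := rfl
    rw [hr, AlgHomClass.commutes, Algebra.algebraMap_eq_smul_one]
    simp
  | id =>
    rw [cfcHom_id ha]
    simpa using h
  | star_id =>
    rw [star_trivial, cfcHom_id ha]
    simpa using h
  | add f g hf hg => simp only [map_add, add_apply, hf, hg, ContinuousMap.add_apply,
      Complex.ofReal_add, add_smul]
  | mul f g hf hg => simp only [map_mul, mul_apply_eq_comp, hf, hg, map_smul, smul_smul,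
      ContinuousMap.mul_apply, Complex.ofReal_mul, mul_comm]
  | frequently f h =>
    have := cfcHom_continuous (R := ℝ) ha
    exact h.mem_of_closed (isClosed_eq (by fun_prop) (by fun_prop))

theorem rpow_apply_of_apply_eq_smul (ha : 0 ≤ a) (h : a v = (μ : ℂ) • v) {α : ℝ} (hα : 0 ≤ α) :
    (a ^ α) v = ((μ ^ α : ℝ) : ℂ) • v := by
  rw [CFC.rpow_eq_cfc_real ha]
  exact cfc_apply_of_apply_eq_smul ha.isSelfAdjoint
    (Real.continuous_rpow_const hα).continuousOn h

end FunctionalCalculus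

section PowerMean

/-- The eigenvalue of `powerMean ρ α` on an eigenvector of `ρ` with eigenvalue `t`. -/
noncomputable def powerMeanValue (α t : ℝ) : ℝ := (t ^ α + t ^ (1 - α)) / 2

theorem continuous_powerMeanValue {α : ℝ} (hα : α ∈ Set.Icc (0 : ℝ) 1) :
    Continuous (powerMeanValue α) :=
  ((Real.continuous_rpow_const hα.1).add
    (Real.continuous_rpow_const (sub_nonneg.2 hα.2))).div_const 2

theorem powerMeanValue_nonneg (α : ℝ) {t : ℝ} (ht : 0 ≤ t) : 0 ≤ powerMeanValue α t := by
  unfold powerMeanValue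
  positivity

theorem le_powerMeanValue_sq (α : ℝ) {t : ℝ} (ht : 0 ≤ t) : t ≤ powerMeanValue α t ^ 2 := by
  rcases ht.eq_or_lt with rfl | htpos
  · positivity
  have h : t ^ α * t ^ (1 - α) = t := by rw [← Real.rpow_add htpos]; simp
  unfold powerMeanValue
  nlinarith [sq_nonneg (t ^ α - t ^ (1 - α))]

variable {H : Type*} [NormedAddCommGroup H] [InnerProductSpace ℂ H] [CompleteSpace H]

theorem powerMean_isSymmetric (ρ : H →L[ℂ] H) (α : ℝ) : (powerMean ρ α).IsSymmetric := by
  have hpow (β : ℝ) : IsSelfAdjoint (ρ ^ β) := CFC.rpow_nonneg.isSelfAdjoint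
  have htwo : IsSelfAdjoint (2⁻¹ : ℂ) := by simp [IsSelfAdjoint]
  exact (htwo.smul ((hpow α).add (hpow (1 - α)))).isSymmetric

theorem powerMean_apply_of_apply_eq_smul {ρ : H →L[ℂ] H} (hρ : 0 ≤ ρ) {v : H} {μ : ℝ}
    (h : ρ v = (μ : ℂ) • v) {α : ℝ} (hα : α ∈ Set.Icc (0 : ℝ) 1) :
    powerMean ρ α v = (powerMeanValue α μ : ℂ) • v := by
  rw [powerMean, smul_apply, add_apply, rpow_apply_of_apply_eq_smul hρ h hα.1,
    rpow_apply_of_apply_eq_smul hρ h (sub_nonneg.2 hα.2), ← add_smul, smul_smul, powerMeanValue]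
  congr 1
  push_cast
  ring

end PowerMean

theorem norm_apply_le_of_hilbertBasis {H : Type*} [NormedAddCommGroup H] [InnerProductSpace ℂ H]
    {κ : Type*} (b : HilbertBasis κ ℂ H) {A : H →L[ℂ] H}
    (hA : A.IsSymmetric) {a : κ → ℝ} (hb : ∀ i, A (b i) = (a i : ℂ) • b i)
    {w : H} {ε : ℝ} (hε : 0 ≤ ε) (h : ∀ i, ⟪b i, w⟫_ℂ ≠ 0 → |a i| ≤ ε) : ‖A w‖ ≤ ε * ‖w‖ := by
  have hparseval (x : H) : HasSum (fun i => ‖⟪b i, x⟫_ℂ‖ ^ 2) (‖x‖ ^ 2) := by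
    simpa [b.repr_apply_apply] using lp.hasSum_norm (by norm_num) (b.repr x)
  have hcoeff (i : κ) : ‖⟪b i, A w⟫_ℂ‖ ^ 2 ≤ ε ^ 2 * ‖⟪b i, w⟫_ℂ‖ ^ 2 := by
    rw [← hA.apply_clm, hb, inner_smul_left, norm_mul, RCLike.norm_conj, Complex.norm_real, mul_pow]
    by_cases hi : ⟪b i, w⟫_ℂ = 0
    · simp [hi]
    · gcongr
      exact h i hi
  refine le_of_sq_le_sq ?_ (by positivity)
  rw [mul_pow]
  exact hasSum_le hcoeff (hparseval (A w)) ((hparseval w).mul_left _)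

namespace SpectralDecomposition

variable {H : Type*} [NormedAddCommGroup H] [InnerProductSpace ℂ H] {ι : Type*} {ρ : H →L[ℂ] H}

theorem exists_eigenvalue_pos (D : SpectralDecomposition ι ρ) : ∃ k, 0 < D.eigenvalue k := by
  by_contra! h
  have hzero : D.eigenvalue = 0 := funext fun k => (h k).antisymm (D.nonneg k)
  exact one_ne_zero ((hzero ▸ D.hasSum_one).unique hasSum_zero)

theorem hasSum_apply (D : SpectralDecomposition ι ρ) (x : H) :
    HasSum (fun k => (D.eigenvalue k : ℂ) • ⟪D.eigenvector k, x⟫_ℂ • D.eigenvector k) (ρ x) := by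
  simpa using D.hasSum_op.mapL (ContinuousLinearMap.apply ℂ H x)

theorem apply_eigenvector (D : SpectralDecomposition ι ρ) (k : ι) :
    ρ (D.eigenvector k) = (D.eigenvalue k : ℂ) • D.eigenvector k := by
  have h := hasSum_single
    (f := fun j => (D.eigenvalue j : ℂ) • ⟪D.eigenvector j, D.eigenvector k⟫_ℂ • D.eigenvector j) k
    fun j hj => by simp [D.orthonormal.2 hj]
  rw [(D.hasSum_apply _).unique h]
  simp [D.orthonormal.1 k]

theorem apply_eq_zero (D : SpectralDecomposition ι ρ) {x : H}
    (hx : ∀ k, ⟪D.eigenvector k, x⟫_ℂ = 0) : ρ x = 0 := by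
  refine (D.hasSum_apply x).unique ?_
  simp [hx, hasSum_zero]

theorem finite_setOf_lt_powerMeanValue (D : SpectralDecomposition ι ρ) {α : ℝ}
    (hα : α ∈ Set.Icc (0 : ℝ) 1) {ε : ℝ} (hε : powerMeanValue α 0 < ε) :
    {k | ε < powerMeanValue α (D.eigenvalue k)}.Finite := by
  have hlim : Filter.Tendsto (fun k => powerMeanValue α (D.eigenvalue k)) Filter.cofinite
      (nhds (powerMeanValue α 0)) :=
    (continuous_powerMeanValue hα).continuousAt.tendsto.comp
      D.hasSum_one.summable.tendsto_cofinite_zero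
  exact (Filter.eventually_cofinite.1 (hlim.eventually_lt_const hε)).subset fun k hk => hk.le.not_gt

variable [CompleteSpace H]

theorem op_nonneg (D : SpectralDecomposition ι ρ) : 0 ≤ ρ :=
  D.hasSum_op.nonneg fun k => (ContinuousLinearMap.nonneg_iff_isPositive _).2 <|
    (InnerProductSpace.isPositive_rankOne_self _).smul_of_nonneg (by simpa using D.nonneg k)

theorem exists_hilbertBasis_of_eigenvectors (D : SpectralDecomposition ι ρ) :
    ∃ (s : Set H) (b : HilbertBasis s ℂ H) (μ : s → ℝ), ∀ i, ρ (b i) = (μ i : ℂ) • b i ∧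
      (μ i = 0 ∨ ∃ k, b i = D.eigenvector k ∧ μ i = D.eigenvalue k) := by
  obtain ⟨s, b, hs, hb⟩ := D.orthonormal.toSubtypeRange.exists_hilbertBasis_extension
  suffices ∀ i : s, ∃ μ : ℝ, ρ (b i) = (μ : ℂ) • b i ∧
      (μ = 0 ∨ ∃ k, b i = D.eigenvector k ∧ μ = D.eigenvalue k) by
    choose μ hμ using this
    exact ⟨s, b, μ, hμ⟩
  intro i
  by_cases hi : ∃ k, b i = D.eigenvector k
  · obtain ⟨k, hk⟩ := hi
    exact ⟨D.eigenvalue k, hk ▸ D.apply_eigenvector k, Or.inr ⟨k, hk, rfl⟩⟩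
  · have horth (k : ι) : ⟪D.eigenvector k, b i⟫_ℂ = 0 := by
      have hk : b ⟨D.eigenvector k, hs ⟨k, rfl⟩⟩ = D.eigenvector k := by rw [hb]
      rw [← hk]
      exact b.orthonormal.2 fun h => hi ⟨k, h ▸ hk⟩
    exact ⟨0, by simp [D.apply_eq_zero horth], Or.inl rfl⟩

theorem norm_powerMean_apply_le (D : SpectralDecomposition ι ρ) {α : ℝ}
    (hα : α ∈ Set.Icc (0 : ℝ) 1) {ε : ℝ} (hε : powerMeanValue α 0 ≤ ε) {w : H}
    (hw : ∀ k, ε < powerMeanValue α (D.eigenvalue k) → ⟪D.eigenvector k, w⟫_ℂ = 0) :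
    ‖powerMean ρ α w‖ ≤ ε * ‖w‖ := by
  obtain ⟨s, b, μ, hμ⟩ := D.exists_hilbertBasis_of_eigenvectors
  refine norm_apply_le_of_hilbertBasis b (powerMean_isSymmetric ρ α)
    (fun i => powerMean_apply_of_apply_eq_smul D.op_nonneg (hμ i).1 hα)
    ((powerMeanValue_nonneg α le_rfl).trans hε) fun i hi => ?_
  obtain hi0 | ⟨k, hbk, hμk⟩ := (hμ i).2
  · rwa [hi0, abs_of_nonneg (powerMeanValue_nonneg α le_rfl)]
  · rw [hμk, abs_of_nonneg (powerMeanValue_nonneg α (D.nonneg k))]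
    exact not_lt.1 fun hlt => hi (hbk ▸ hw k hlt)

end SpectralDecomposition

section Centered

variable {H : Type*} [NormedAddCommGroup H] [InnerProductSpace ℂ H] {ι : Type*} {ρ : H →L[ℂ] H}

theorem centered_apply (D : SpectralDecomposition ι ρ) (T : H →ₗ.[ℂ] H)
    (hDT : ∀ k, D.eigenvector k ∈ T.domain) {x : H} (hx : x ∈ T.domain) :
    centered D T hDT ⟨x, hx⟩ = T ⟨x, hx⟩ - traceWith D T hDT • x := by
  have h : centered D T hDT ⟨x, hx⟩ =
      (-(traceWith D T hDT • (LinearMap.id : H →ₗ[ℂ] H))) x + T ⟨x, hx⟩ :=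
    LinearPMap.vadd_apply _ _ _
  rw [h]
  simp [sub_eq_neg_add]

theorem conj_traceWith (D : SpectralDecomposition ι ρ) {T : H →ₗ.[ℂ] H} (hT : T.IsFormalAdjoint T)
    (hDT : ∀ k, D.eigenvector k ∈ T.domain) :
    (starRingEnd ℂ) (traceWith D T hDT) = traceWith D T hDT := by
  rw [traceWith, Complex.conj_tsum]
  refine tsum_congr fun k => ?_
  rw [map_mul, Complex.conj_ofReal, inner_conj_symm, hT ⟨_, hDT k⟩ ⟨_, hDT k⟩]

theorem centered_isFormalAdjoint (D : SpectralDecomposition ι ρ) {T : H →ₗ.[ℂ] H}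
    (hT : T.IsFormalAdjoint T) (hDT : ∀ k, D.eigenvector k ∈ T.domain) :
    (centered D T hDT).IsFormalAdjoint (centered D T hDT) := by
  rintro ⟨x, hx⟩ ⟨y, hy⟩
  rw [centered_apply D T hDT hx, centered_apply D T hDT hy, inner_sub_left, inner_sub_right,
    inner_smul_left, inner_smul_right, conj_traceWith D hT]
  congr 1
  exact hT ⟨x, hx⟩ ⟨y, hy⟩

theorem im_inner_centered (D : SpectralDecomposition ι ρ) {X Y : H →ₗ.[ℂ] H}
    (hX : X.IsFormalAdjoint X) (hY : Y.IsFormalAdjoint Y)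
    (hDX : ∀ k, D.eigenvector k ∈ X.domain) (hDY : ∀ k, D.eigenvector k ∈ Y.domain)
    {x : H} (hxX : x ∈ X.domain) (hxY : x ∈ Y.domain) :
    (⟪centered D X hDX ⟨x, hxX⟩, centered D Y hDY ⟨x, hxY⟩⟫_ℂ).im =
      (⟪X ⟨x, hxX⟩, Y ⟨x, hxY⟩⟫_ℂ).im := by
  have htraceX := Complex.conj_eq_iff_im.1 (conj_traceWith D hX hDX)
  have htraceY := Complex.conj_eq_iff_im.1 (conj_traceWith D hY hDY)
  have hXx : (⟪X ⟨x, hxX⟩, x⟫_ℂ).im = 0 := Complex.conj_eq_iff_im.1 <| by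
    rw [inner_conj_symm, hX ⟨x, hxX⟩ ⟨x, hxX⟩]
  have hYx : (⟪x, Y ⟨x, hxY⟩⟫_ℂ).im = 0 := Complex.conj_eq_iff_im.1 <| by
    rw [inner_conj_symm, hY ⟨x, hxY⟩ ⟨x, hxY⟩]
  rw [centered_apply D X hDX hxX, centered_apply D Y hDY hxY]
  simp [htraceX, htraceY, hXx, hYx, ← Complex.ofReal_pow]

end Centered

section Commutator

variable {H : Type*} [NormedAddCommGroup H] [InnerProductSpace ℂ H] {X Y : H →ₗ.[ℂ] H} {c : ℂ}

theorem eq_two_mul_im_inner_mul_I (hX : X.IsFormalAdjoint X) (hY : Y.IsFormalAdjoint Y) {x : H}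
    (hx : x ∈ (commutator X Y).domain) (hXY : commutator X Y ⟨x, hx⟩ = c • x) (hx1 : ‖x‖ = 1) :
    c = (2 * (⟪X ⟨x, mem_domain_left hx⟩, Y ⟨x, mem_domain_right hx⟩⟫_ℂ).im : ℝ) *
      Complex.I := by
  have hcomm : commutator X Y ⟨x, hx⟩ =
      X ⟨Y ⟨x, mem_domain_right hx⟩, hx.1.2⟩ - Y ⟨X ⟨x, mem_domain_left hx⟩, hx.2.2⟩ := rfl
  calc c = ⟪x, commutator X Y ⟨x, hx⟩⟫_ℂ := by
        rw [hXY, inner_smul_right, inner_self_eq_norm_sq_to_K, hx1]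
        simp
    _ = ⟪X ⟨x, mem_domain_left hx⟩, Y ⟨x, mem_domain_right hx⟩⟫_ℂ -
          ⟪Y ⟨x, mem_domain_right hx⟩, X ⟨x, mem_domain_left hx⟩⟫_ℂ := by
        rw [hcomm, inner_sub_right,
          hX ⟨x, mem_domain_left hx⟩ ⟨Y ⟨x, mem_domain_right hx⟩, hx.1.2⟩,
          hY ⟨x, mem_domain_right hx⟩ ⟨X ⟨x, mem_domain_left hx⟩, hx.2.2⟩]
    _ = _ := by
        rw [← inner_conj_symm (Y _), Complex.sub_conj]

theorem traceWith_commutator {ι : Type*} {ρ : H →L[ℂ] H} (D : SpectralDecomposition ι ρ)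
    (hXY : ∀ x : (commutator X Y).domain, commutator X Y x = c • (x : H))
    (hD : ∀ k, D.eigenvector k ∈ (commutator X Y).domain) :
    traceWith D (commutator X Y) hD = c := by
  have hterm (k : ι) : (D.eigenvalue k : ℂ) *
      ⟪D.eigenvector k, commutator X Y ⟨D.eigenvector k, hD k⟩⟫_ℂ = D.eigenvalue k * c := by
    rw [hXY, inner_smul_right, inner_self_eq_norm_sq_to_K, D.orthonormal.1 k]
    simp
  have hsum : HasSum (fun k => (D.eigenvalue k : ℂ) * c) c := by
    simpa using (Complex.hasSum_ofReal.2 D.hasSum_one).mul_right c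
  simp only [traceWith, hterm, hsum.tsum_eq]

end Commutator

section Uncertainty

variable {H : Type*} [NormedAddCommGroup H] [InnerProductSpace ℂ H] [CompleteSpace H]
  {ι : Type*} {ρ : H →L[ℂ] H} (D : SpectralDecomposition ι ρ)

theorem sq_two_mul_sum_le_traceSq_mul_traceSq_of_lt {X Y : H →ₗ.[ℂ] H} (hX : X.IsFormalAdjoint X)
    (hdX : Dense (X.domain : Set H)) (hY : Y.IsFormalAdjoint Y) (hdY : Dense (Y.domain : Set H))
    (hDX : ∀ k, D.eigenvector k ∈ X.domain) (hDY : ∀ k, D.eigenvector k ∈ Y.domain)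
    {d : ℝ} (hd : ∀ k, (⟪X ⟨_, hDX k⟩, Y ⟨_, hDY k⟩⟫_ℂ).im = d)
    {α : ℝ} (hα : α ∈ Set.Icc (0 : ℝ) 1) {ε : ℝ} (hε : powerMeanValue α 0 < ε) (G : Finset ι) :
    ENNReal.ofReal
        ((2 * ((∑ k ∈ G, max (powerMeanValue α (D.eigenvalue k) - ε) 0 ^ 2) * d)) ^ 2) ≤
      traceSq (commForm (powerMean ρ α) (centered D X hDX)) *
        traceSq (anticommForm (powerMean ρ α) (centered D Y hDY)) := by
  classical
  let a (k : ι) : ℝ := powerMeanValue α (D.eigenvalue k)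
  let F : Finset ι := G ∪ (D.finite_setOf_lt_powerMeanValue hα hε).toFinset
  have hF (k : ι) (hk : ε < a k) : k ∈ F := Finset.mem_union_right _ (by simpa using hk)
  have hGF : ∑ k ∈ G, max (a k - ε) 0 ^ 2 ≤ ∑ k ∈ F, max (a k - ε) 0 ^ 2 :=
    Finset.sum_le_sum_of_subset_of_nonneg Finset.subset_union_left fun _ _ _ => sq_nonneg _
  have hfinite := sq_two_mul_sum_im_inner_le_traceSq_mul_traceSq (φ := fun k : F => D.eigenvector k)
    (a := fun k => a k) (powerMean_isSymmetric ρ α)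
    (centered_isFormalAdjoint D hX hDX) hdX (centered_isFormalAdjoint D hY hDY) hdY
    (D.orthonormal.comp _ Subtype.val_injective) (fun k => hDX k) (fun k => hDY k)
    (fun k => powerMean_apply_of_apply_eq_smul D.op_nonneg (D.apply_eigenvector k) hα)
    (fun k => powerMeanValue_nonneg α (D.nonneg k))
    ((powerMeanValue_nonneg α le_rfl).trans hε.le)
    (fun w hw => D.norm_powerMean_apply_le hα hε.le fun k hk => hw ⟨k, hF k hk⟩)
  refine le_trans (ENNReal.ofReal_le_ofReal ?_) hfinite
  simp only [im_inner_centered D hX hY hDX hDY, hd]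
  rw [← Finset.sum_mul, Finset.sum_coe_sort F fun k => max (a k - ε) 0 ^ 2]
  simp only [mul_pow]
  gcongr

theorem sq_sum_mul_le_skewK_mul_skewL {X Y : H →ₗ.[ℂ] H} (hX : X.IsFormalAdjoint X)
    (hdX : Dense (X.domain : Set H)) (hY : Y.IsFormalAdjoint Y) (hdY : Dense (Y.domain : Set H))
    (hDX : ∀ k, D.eigenvector k ∈ X.domain) (hDY : ∀ k, D.eigenvector k ∈ Y.domain)
    {d : ℝ} (hd : ∀ k, (⟪X ⟨_, hDX k⟩, Y ⟨_, hDY k⟩⟫_ℂ).im = d)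
    {α : ℝ} (hα : α ∈ Set.Icc (0 : ℝ) 1) (G : Finset ι) :
    ENNReal.ofReal (((∑ k ∈ G,
        max (powerMeanValue α (D.eigenvalue k) - powerMeanValue α 0) 0 ^ 2) * d) ^ 2) ≤
      skewK D α X hDX * skewL D α Y hDY := by
  set s : ℝ → ℝ := fun ε => ∑ k ∈ G, max (powerMeanValue α (D.eigenvalue k) - ε) 0 ^ 2
  have hs : Continuous fun ε => ENNReal.ofReal ((2 * (s ε * d)) ^ 2) :=
    ENNReal.continuous_ofReal.comp (by fun_prop)
  have hlim := (hs.tendsto (powerMeanValue α 0)).mono_left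
    (nhdsWithin_le_nhds (s := Set.Ioi (powerMeanValue α 0)))
  have hle := le_of_tendsto hlim <| Filter.eventually_of_mem self_mem_nhdsWithin fun ε hε =>
    sq_two_mul_sum_le_traceSq_mul_traceSq_of_lt D hX hdX hY hdY hDX hDY hd hα hε G
  have hfour : (2⁻¹ * 2⁻¹ : ℝ≥0∞) = ENNReal.ofReal (2⁻¹ * 2⁻¹) := by
    rw [ENNReal.ofReal_mul (by norm_num), ENNReal.ofReal_inv_of_pos two_pos, ENNReal.ofReal_ofNat]
  calc ENNReal.ofReal ((s (powerMeanValue α 0) * d) ^ 2)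
      = 2⁻¹ * 2⁻¹ * ENNReal.ofReal ((2 * (s (powerMeanValue α 0) * d)) ^ 2) := by
        rw [hfour, ← ENNReal.ofReal_mul (by norm_num)]
        congr 1
        ring
    _ ≤ skewK D α X hDX * skewL D α Y hDY := by
        rw [skewK, skewL, mul_mul_mul_comm]
        gcongr

theorem powerMeanValue_zero_of_mem_Ioo {α : ℝ} (hα : α ∈ Set.Ioo (0 : ℝ) 1) :
    powerMeanValue α 0 = 0 := by
  simp [powerMeanValue, Real.zero_rpow hα.1.ne', Real.zero_rpow (sub_pos.2 hα.2).ne']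

theorem sq_le_skewK_mul_skewL {X Y : H →ₗ.[ℂ] H} (hX : X.IsFormalAdjoint X)
    (hdX : Dense (X.domain : Set H)) (hY : Y.IsFormalAdjoint Y) (hdY : Dense (Y.domain : Set H))
    (hDX : ∀ k, D.eigenvector k ∈ X.domain) (hDY : ∀ k, D.eigenvector k ∈ Y.domain)
    {d : ℝ} (hd : ∀ k, (⟪X ⟨_, hDX k⟩, Y ⟨_, hDY k⟩⟫_ℂ).im = d)
    {α : ℝ} (hα : α ∈ Set.Ioo (0 : ℝ) 1) :
    ENNReal.ofReal (d ^ 2) ≤ skewK D α X hDX * skewL D α Y hDY := by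
  have hlim : Filter.Tendsto
      (fun G : Finset ι => ENNReal.ofReal (((∑ k ∈ G, D.eigenvalue k) * d) ^ 2))
      Filter.atTop (nhds (ENNReal.ofReal ((1 * d) ^ 2))) :=
    (ENNReal.continuous_ofReal.tendsto _).comp ((D.hasSum_one.mul_const d).pow 2)
  rw [one_mul] at hlim
  refine le_of_tendsto' hlim fun G => le_trans (ENNReal.ofReal_le_ofReal ?_) <|
    sq_sum_mul_le_skewK_mul_skewL D hX hdX hY hdY hDX hDY hd (Set.Ioo_subset_Icc_self hα) G
  have hterm (k : ι) : D.eigenvalue k ≤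
      max (powerMeanValue α (D.eigenvalue k) - powerMeanValue α 0) 0 ^ 2 := by
    rw [powerMeanValue_zero_of_mem_Ioo hα, sub_zero,
      max_eq_left (powerMeanValue_nonneg α (D.nonneg k))]
    exact le_powerMeanValue_sq α (D.nonneg k)
  have hsum0 : 0 ≤ ∑ k ∈ G, D.eigenvalue k := Finset.sum_nonneg fun k _ => D.nonneg k
  simp only [mul_pow]
  gcongr
  exact hterm _

end Uncertainty

section BoundedCommutator

theorem mul_pow_succ_sub_pow_succ_mul {R B : Type*} [CommRing R] [Ring B] [Algebra R B]
    {x y : B} {c : R} (h : x * y - y * x = c • (1 : B)) (n : ℕ) :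
    x * y ^ (n + 1) - y ^ (n + 1) * x = ((n + 1 : ℕ) * c) • y ^ n := by
  induction n with
  | zero => simpa using h
  | succ n ih =>
    calc x * y ^ (n + 1 + 1) - y ^ (n + 1 + 1) * x
        = (x * y ^ (n + 1) - y ^ (n + 1) * x) * y + y ^ (n + 1) * (x * y - y * x) := by
          simp only [pow_succ, sub_mul, mul_sub, mul_assoc]
          abel
      _ = ((n + 1 + 1 : ℕ) * c) • y ^ (n + 1) := by
          rw [ih, h, smul_mul_assoc, ← pow_succ, mul_smul_comm, mul_one, ← add_smul]
          congr 1
          push_cast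
          ring

theorem mul_sub_mul_ne_smul_one {B : Type*} [NormedRing B] [NormedAlgebra ℂ B] [Nontrivial B]
    (x y : B) {c : ℂ} (hc : c ≠ 0) : x * y - y * x ≠ c • (1 : B) := by
  intro h
  have hpow := mul_pow_succ_sub_pow_succ_mul h
  have hne (n : ℕ) : y ^ n ≠ 0 := by
    induction n with
    | zero => simp
    | succ n ih =>
      intro hzero
      have hsmul := hpow n
      rw [hzero, mul_zero, zero_mul, sub_zero, eq_comm, smul_eq_zero] at hsmul
      exact hsmul.elim (mul_ne_zero (Nat.cast_ne_zero.2 n.succ_ne_zero) hc) ih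
  have hbound (n : ℕ) : (n + 1) * ‖c‖ ≤ 2 * ‖x‖ * ‖y‖ := by
    refine le_of_mul_le_mul_right ?_ (norm_pos_iff.2 (hne n))
    calc (n + 1) * ‖c‖ * ‖y ^ n‖ = ‖x * (y ^ n * y) - y ^ n * y * x‖ := by
          rw [← pow_succ, hpow, norm_smul, norm_mul, Complex.norm_natCast, Nat.cast_succ]
      _ ≤ ‖x‖ * (‖y ^ n‖ * ‖y‖) + ‖y ^ n‖ * ‖y‖ * ‖x‖ := by
          refine (norm_sub_le _ _).trans (add_le_add ?_ ?_)
          · exact (norm_mul_le _ _).trans (by gcongr; exact norm_mul_le _ _)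
          · exact (norm_mul_le _ _).trans (by gcongr; exact norm_mul_le _ _)
      _ = 2 * ‖x‖ * ‖y‖ * ‖y ^ n‖ := by ring
  obtain ⟨n, hn⟩ := exists_nat_gt (2 * ‖x‖ * ‖y‖ / ‖c‖)
  rw [div_lt_iff₀ (norm_pos_iff.2 hc)] at hn
  linarith [hbound n, norm_nonneg c]

theorem not_domain_eq_top_of_commutator {H : Type*} [NormedAddCommGroup H] [InnerProductSpace ℂ H]
    [CompleteSpace H] [Nontrivial H] {X Y : H →ₗ.[ℂ] H} (hX : X.IsFormalAdjoint X)
    (hY : Y.IsFormalAdjoint Y) {c : ℂ} (hc : c ≠ 0)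
    (hXY : ∀ x : (commutator X Y).domain, commutator X Y x = c • (x : H)) :
    ¬(X.domain = ⊤ ∧ Y.domain = ⊤) := by
  rintro ⟨hXtop, hYtop⟩
  have memX (x : H) : x ∈ X.domain := hXtop ▸ Submodule.mem_top
  have memY (x : H) : x ∈ Y.domain := hYtop ▸ Submodule.mem_top
  let LX : H →ₗ[ℂ] H := X.toFun ∘ₗ LinearMap.id.codRestrict X.domain memX
  let LY : H →ₗ[ℂ] H := Y.toFun ∘ₗ LinearMap.id.codRestrict Y.domain memY
  have hLX : LX.IsSymmetric := fun x y => hX ⟨x, memX x⟩ ⟨y, memX y⟩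
  have hLY : LY.IsSymmetric := fun x y => hY ⟨x, memY x⟩ ⟨y, memY y⟩
  refine mul_sub_mul_ne_smul_one (⟨LX, hLX.continuous⟩ : H →L[ℂ] H) ⟨LY, hLY.continuous⟩ hc ?_
  ext x
  exact hXY ⟨x, ⟨⟨memY x, memX _⟩, ⟨memX x, memY _⟩⟩⟩

end BoundedCommutator

section EverywhereDefined

variable {H : Type*} [NormedAddCommGroup H] [InnerProductSpace ℂ H]

theorem norm_le_of_dense_inner_le {V : Submodule ℂ H} (hV : Dense (V : Set H)) {v : H} {C : ℝ}
    (hC : 0 ≤ C) (h : ∀ x ∈ V, ‖⟪v, x⟫_ℂ‖ ≤ C * ‖x‖) : ‖v‖ ≤ C := by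
  have hclosed : IsClosed {x : H | ‖⟪v, x⟫_ℂ‖ ≤ C * ‖x‖} :=
    isClosed_le (by fun_prop) (by fun_prop)
  have hv : ‖⟪v, v⟫_ℂ‖ ≤ C * ‖v‖ := hclosed.closure_subset_iff.2 h (hV v)
  rw [inner_self_eq_norm_sq_to_K, norm_pow, RCLike.norm_ofReal, abs_norm, sq] at hv
  rcases (norm_nonneg v).eq_or_lt with h0 | h0
  · rwa [← h0]
  · exact le_of_mul_le_mul_right hv h0

theorem norm_anticommForm_le_sqrt_traceSq {A : H →L[ℂ] H} {T : H →ₗ.[ℂ] H}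
    (hfin : traceSq (anticommForm A T) ≠ ∞) (x y : T.domain) :
    ‖anticommForm A T x y‖ ≤ √(traceSq (anticommForm A T)).toReal * ‖x‖ * ‖y‖ :=
  norm_apply_le_sqrt_traceSq
    (LinearMap.mk₂'ₛₗ (starRingEnd ℂ) (RingHom.id ℂ) (anticommForm A T)
      (fun x x' y => by
        simp only [anticommForm, Submodule.coe_add, map_add, T.map_add, inner_add_left]
        ring)
      (fun c x y => by
        simp only [anticommForm, Submodule.coe_smul, map_smul, T.map_smul, inner_smul_left,
          smul_eq_mul]
        ring)
      (fun x y y' => by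
        simp only [anticommForm, Submodule.coe_add, map_add, T.map_add, inner_add_right]
        ring)
      (fun c x y => by
        simp only [anticommForm, Submodule.coe_smul, map_smul, T.map_smul, inner_smul_right,
          smul_eq_mul, RingHom.id_apply]
        ring)) hfin x y

theorem norm_apply_eigenvector_le_sqrt_traceSq {A : H →L[ℂ] H} (hA : A.IsSymmetric)
    (hcoer : ∀ w, 2⁻¹ * ‖w‖ ^ 2 ≤ (⟪w, A w⟫_ℂ).re) {T : H →ₗ.[ℂ] H} (hT : T.IsFormalAdjoint T)
    (hdT : Dense (T.domain : Set H)) (hfin : traceSq (anticommForm A T) ≠ ∞) {x : T.domain}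
    (hx1 : ‖x‖ = 1) {a : ℝ} (hx : A x = (a : ℂ) • (x : H)) :
    ‖T x‖ ≤ √(traceSq (anticommForm A T)).toReal := by
  set C := √(traceSq (anticommForm A T)).toReal
  have hrow : ‖a • T x + A (T x)‖ ≤ C := by
    refine norm_le_of_dense_inner_le hdT (Real.sqrt_nonneg _) fun y hy => ?_
    have h := norm_anticommForm_le_sqrt_traceSq hfin x ⟨y, hy⟩
    rwa [anticommForm_eigenvector hA hT hx, hx1, mul_one] at h
  have ha : 2⁻¹ ≤ a := by
    have h := hcoer x
    rw [hx, inner_smul_right, inner_self_eq_norm_sq_to_K] at h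
    simpa [-Complex.ofReal_pow, show ‖(x : H)‖ = 1 from hx1] using h
  rcases (norm_nonneg (T x)).eq_or_lt with hzero | hpos
  · rw [← hzero]
    exact Real.sqrt_nonneg _
  refine le_of_mul_le_mul_left ?_ hpos
  calc ‖T x‖ * ‖T x‖ ≤ a * ‖T x‖ ^ 2 + (⟪T x, A (T x)⟫_ℂ).re := by
        nlinarith [hcoer (T x)]
    _ = (⟪T x, a • T x + A (T x)⟫_ℂ).re := by
        rw [inner_add_right, RCLike.real_smul_eq_coe_smul (K := ℂ), inner_smul_right,
          inner_self_eq_norm_sq_to_K, Complex.add_re, ← RCLike.ofReal_pow]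
        simp [-Complex.ofReal_pow]
    _ ≤ ‖T x‖ * ‖a • T x + A (T x)‖ := re_inner_le_norm (𝕜 := ℂ) _ _
    _ ≤ ‖T x‖ * C := by gcongr

theorem norm_inner_op_apply_le {ι : Type*} {ρ : H →L[ℂ] H} (D : SpectralDecomposition ι ρ)
    {v : H} {C : ℝ} (hv : ∀ k, ‖⟪D.eigenvector k, v⟫_ℂ‖ ≤ C) (x : H) :
    ‖⟪ρ x, v⟫_ℂ‖ ≤ C * ‖x‖ := by
  rw [norm_inner_symm]
  refine ((D.hasSum_apply x).mapL (innerSL ℂ v)).norm_le_of_bounded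
    (by simpa using D.hasSum_one.mul_right (C * ‖x‖)) fun k => ?_
  have hC : 0 ≤ C := (norm_nonneg _).trans (hv k)
  simp only [innerSL_apply_apply, inner_smul_right, norm_mul, Complex.norm_real, Real.norm_eq_abs,
    abs_of_nonneg (D.nonneg k)]
  gcongr _ * ?_
  · exact D.nonneg k
  rw [mul_comm, norm_inner_symm]
  gcongr
  · exact hv k
  · simpa [D.orthonormal.1 k] using norm_inner_le_norm (𝕜 := ℂ) (D.eigenvector k) x

end EverywhereDefined

section ExtremeExponent

variable {H : Type*} [NormedAddCommGroup H] [InnerProductSpace ℂ H] [CompleteSpace H]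

theorem isFormalAdjoint_of_isSelfAdjoint {T : H →ₗ.[ℂ] H} (hT : IsSelfAdjoint T) :
    T.IsFormalAdjoint T := by
  have h := LinearPMap.adjoint_isFormalAdjoint hT.dense_domain
  rwa [LinearPMap.isSelfAdjoint_def.1 hT] at h

theorem domain_eq_top_of_norm_apply_le {T : H →ₗ.[ℂ] H} (hT : IsSelfAdjoint T) {C : ℝ}
    (h : ∀ x : T.domain, ‖T x‖ ≤ C * ‖x‖) : T.domain = ⊤ := by
  rw [Submodule.eq_top_iff']
  intro y
  rw [← LinearPMap.isSelfAdjoint_def.1 hT, LinearPMap.mem_adjoint_domain_iff]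
  refine AddMonoidHomClass.continuous_of_bound _ (‖y‖ * C) fun x => ?_
  rw [mul_assoc]
  exact (norm_inner_le_norm y (T x)).trans (mul_le_mul_of_nonneg_left (h x) (norm_nonneg y))

variable {ι : Type*} {ρ : H →L[ℂ] H} (D : SpectralDecomposition ι ρ) {α : ℝ}

theorem powerMeanValue_of_extreme (hα : α = 0 ∨ α = 1) (t : ℝ) :
    powerMeanValue α t = (1 + t) / 2 := by
  rcases hα with rfl | rfl <;> simp [powerMeanValue, add_comm]

theorem powerMean_apply_of_extreme (hρ : 0 ≤ ρ) (hα : α = 0 ∨ α = 1) (x : H) :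
    powerMean ρ α x = (2⁻¹ : ℂ) • (x + ρ x) := by
  rcases hα with rfl | rfl <;> simp [powerMean, CFC.rpow_zero ρ, CFC.rpow_one ρ, add_comm]

theorem half_norm_sq_le_re_inner_powerMean (hρ : 0 ≤ ρ) (hα : α = 0 ∨ α = 1) (w : H) :
    2⁻¹ * ‖w‖ ^ 2 ≤ (⟪w, powerMean ρ α w⟫_ℂ).re := by
  have hpos : 0 ≤ (⟪w, ρ w⟫_ℂ).re :=
    ((ContinuousLinearMap.nonneg_iff_isPositive _).1 hρ).re_inner_nonneg_right w
  have hre : (⟪w, powerMean ρ α w⟫_ℂ).re = 2⁻¹ * (‖w‖ ^ 2 + (⟪w, ρ w⟫_ℂ).re) := by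
    rw [powerMean_apply_of_extreme hρ hα, inner_smul_right, inner_add_right,
      inner_self_eq_norm_sq_to_K]
    simp [← Complex.ofReal_pow]
  linarith

theorem norm_apply_le_of_traceSq_anticommForm_ne_top (hα : α = 0 ∨ α = 1) {T : H →ₗ.[ℂ] H}
    (hT : T.IsFormalAdjoint T) (hdT : Dense (T.domain : Set H))
    (hDT : ∀ k, D.eigenvector k ∈ T.domain) (hfin : traceSq (anticommForm (powerMean ρ α) T) ≠ ∞)
    (y : T.domain) :
    ‖T y‖ ≤ 2 * √(traceSq (anticommForm (powerMean ρ α) T)).toReal * ‖y‖ := by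
  set C := √(traceSq (anticommForm (powerMean ρ α) T)).toReal
  have hαmem : α ∈ Set.Icc (0 : ℝ) 1 := by rcases hα with rfl | rfl <;> simp
  have hA := powerMean_apply_of_extreme D.op_nonneg hα
  have heigen (k : ι) : ‖T ⟨D.eigenvector k, hDT k⟩‖ ≤ C :=
    norm_apply_eigenvector_le_sqrt_traceSq (powerMean_isSymmetric ρ α)
      (half_norm_sq_le_re_inner_powerMean D.op_nonneg hα) hT hdT hfin (D.orthonormal.1 k)
      (powerMean_apply_of_apply_eq_smul D.op_nonneg (D.apply_eigenvector k) hαmem)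
  have hρ (x : H) (z : T.domain) : ‖⟪ρ x, T z⟫_ℂ‖ ≤ C * ‖z‖ * ‖x‖ := by
    refine norm_inner_op_apply_le D (fun k => ?_) x
    rw [← hT ⟨D.eigenvector k, hDT k⟩ z]
    exact (norm_inner_le_norm _ _).trans (mul_le_mul_of_nonneg_right (heigen k) (norm_nonneg _))
  refine norm_le_of_dense_inner_le hdT (by positivity) fun x hx => ?_
  have hform : ⟪T y, x⟫_ℂ = anticommForm (powerMean ρ α) T y ⟨x, hx⟩ -
      2⁻¹ * (⟪ρ y, T ⟨x, hx⟩⟫_ℂ + ⟪T y, ρ x⟫_ℂ) := by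
    have hsymm : ⟪T y, x⟫_ℂ = ⟪(y : H), T ⟨x, hx⟩⟫_ℂ := hT y ⟨x, hx⟩
    simp only [anticommForm, hA, inner_smul_left, inner_smul_right, inner_add_left,
      inner_add_right, hsymm, map_inv₀, map_ofNat]
    ring
  have hanti := norm_anticommForm_le_sqrt_traceSq hfin y ⟨x, hx⟩
  have hleft := hρ y ⟨x, hx⟩
  have hright := hρ x y
  rw [norm_inner_symm] at hright
  calc ‖⟪T y, x⟫_ℂ‖ ≤ C * ‖y‖ * ‖x‖ + 2⁻¹ * (C * ‖x‖ * ‖y‖ + C * ‖y‖ * ‖x‖) := by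
        rw [hform]
        refine (norm_sub_le _ _).trans (add_le_add hanti ?_)
        rw [norm_mul, norm_inv, RCLike.norm_ofNat]
        gcongr
        exact (norm_add_le _ _).trans (add_le_add hleft hright)
    _ = 2 * C * ‖y‖ * ‖x‖ := by ring

theorem domain_eq_top_of_skewL_ne_top (hα : α = 0 ∨ α = 1) {T : H →ₗ.[ℂ] H}
    (hT : IsSelfAdjoint T) (hDT : ∀ k, D.eigenvector k ∈ T.domain) (hfin : skewL D α T hDT ≠ ∞) :
    T.domain = ⊤ := by
  have hbound := norm_apply_le_of_traceSq_anticommForm_ne_top D hα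
    (centered_isFormalAdjoint D (isFormalAdjoint_of_isSelfAdjoint hT) hDT) hT.dense_domain hDT
    (fun h => hfin (by rw [skewL, h, ENNReal.mul_top (by simp)]))
  set C := 2 * √(traceSq (anticommForm (powerMean ρ α) (centered D T hDT))).toReal
  refine domain_eq_top_of_norm_apply_le hT (C := C + ‖traceWith D T hDT‖) fun x => ?_
  rw [eq_add_of_sub_eq (centered_apply D T hDT x.2).symm, add_mul, ← norm_smul]
  exact (norm_add_le _ _).trans (add_le_add (hbound x) le_rfl)

theorem skewK_mul_skewL_ne_zero (hα : α = 0 ∨ α = 1) {X Y : H →ₗ.[ℂ] H}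
    (hX : X.IsFormalAdjoint X) (hdX : Dense (X.domain : Set H))
    (hY : Y.IsFormalAdjoint Y) (hdY : Dense (Y.domain : Set H))
    (hDX : ∀ k, D.eigenvector k ∈ X.domain) (hDY : ∀ k, D.eigenvector k ∈ Y.domain)
    {d : ℝ} (hd : ∀ k, (⟪X ⟨_, hDX k⟩, Y ⟨_, hDY k⟩⟫_ℂ).im = d) (hd0 : d ≠ 0) :
    skewK D α X hDX * skewL D α Y hDY ≠ 0 := by
  have hαmem : α ∈ Set.Icc (0 : ℝ) 1 := by rcases hα with rfl | rfl <;> simp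
  obtain ⟨k, hk⟩ := D.exists_eigenvalue_pos
  have hle := sq_sum_mul_le_skewK_mul_skewL D hX hdX hY hdY hDX hDY hd hαmem {k}
  have hgap : powerMeanValue α (D.eigenvalue k) - powerMeanValue α 0 = D.eigenvalue k / 2 := by
    rw [powerMeanValue_of_extreme hα, powerMeanValue_of_extreme hα]
    ring
  rw [Finset.sum_singleton, hgap, max_eq_left (by positivity)] at hle
  exact (lt_of_lt_of_le (ENNReal.ofReal_pos.2 (by positivity)) hle).ne'

end ExtremeExponent

section Product

variable {H : Type*} [NormedAddCommGroup H] [InnerProductSpace ℂ H] [CompleteSpace H]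
  {ι : Type*} {ρ : H →L[ℂ] H} (D : SpectralDecomposition ι ρ) {α d : ℝ} {X Y : H →ₗ.[ℂ] H}
  (hDX : ∀ k, D.eigenvector k ∈ X.domain) (hDY : ∀ k, D.eigenvector k ∈ Y.domain)

theorem skewW_mul_skewW : skewW D α X hDX * skewW D α Y hDY =
    ((skewK D α X hDX * skewL D α Y hDY) * (skewK D α Y hDY * skewL D α X hDX)) ^ (1 / 2 : ℝ) := by
  rw [skewW, skewW, ← ENNReal.mul_rpow_of_nonneg _ _ (by norm_num)]
  congr 1
  ring

theorem sq_le_skewW_mul_skewW (hα : α ∈ Set.Ioo (0 : ℝ) 1)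
    (hX : X.IsFormalAdjoint X) (hdX : Dense (X.domain : Set H))
    (hY : Y.IsFormalAdjoint Y) (hdY : Dense (Y.domain : Set H))
    (hd : ∀ k, (⟪X ⟨_, hDX k⟩, Y ⟨_, hDY k⟩⟫_ℂ).im = d) :
    ENNReal.ofReal (d ^ 2) ≤ skewW D α X hDX * skewW D α Y hDY := by
  have hXY := sq_le_skewK_mul_skewL D hX hdX hY hdY hDX hDY hd hα
  have hYX := sq_le_skewK_mul_skewL D hY hdY hX hdX hDY hDX (d := -d)
    (fun k => by rw [← inner_conj_symm, Complex.conj_im, hd]) hα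
  rw [neg_sq] at hYX
  calc ENNReal.ofReal (d ^ 2)
      = (ENNReal.ofReal (d ^ 2) * ENNReal.ofReal (d ^ 2)) ^ (1 / 2 : ℝ) := by
        rw [← sq, ← ENNReal.rpow_natCast, ← ENNReal.rpow_mul]
        norm_num
    _ ≤ skewW D α X hDX * skewW D α Y hDY := by
        rw [skewW_mul_skewW]
        gcongr

theorem skewW_mul_skewW_eq_top (hα : α = 0 ∨ α = 1) (hX : IsSelfAdjoint X) (hY : IsSelfAdjoint Y)
    (hd : ∀ k, (⟪X ⟨_, hDX k⟩, Y ⟨_, hDY k⟩⟫_ℂ).im = d) (hd0 : d ≠ 0)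
    (hdom : ¬(X.domain = ⊤ ∧ Y.domain = ⊤)) :
    skewW D α X hDX * skewW D α Y hDY = ∞ := by
  have hXs := isFormalAdjoint_of_isSelfAdjoint hX
  have hYs := isFormalAdjoint_of_isSelfAdjoint hY
  have hXY := skewK_mul_skewL_ne_zero D hα hXs hX.dense_domain hYs hY.dense_domain hDX hDY hd hd0
  have hYX := skewK_mul_skewL_ne_zero D hα hYs hY.dense_domain hXs hX.dense_domain hDY hDX
    (d := -d) (fun k => by rw [← inner_conj_symm, Complex.conj_im, hd]) (neg_ne_zero.2 hd0)
  have hL : skewL D α Y hDY = ∞ ∨ skewL D α X hDX = ∞ := by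
    by_contra! h
    exact hdom ⟨domain_eq_top_of_skewL_ne_top D hα hX hDX h.2,
      domain_eq_top_of_skewL_ne_top D hα hY hDY h.1⟩
  rw [skewW_mul_skewW]
  suffices h : (skewK D α X hDX * skewL D α Y hDY) * (skewK D α Y hDY * skewL D α X hDX) = ∞ by
    rw [h, ENNReal.top_rpow_of_pos (by norm_num)]
  rcases hL with h | h
  · rw [h, ENNReal.mul_top (left_ne_zero_of_mul hXY), ENNReal.top_mul hYX]
  · rw [h, ENNReal.mul_top (left_ne_zero_of_mul hYX), ENNReal.mul_top hXY]

end Product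

end SkewInformation

open SkewInformation in
theorem mainTheorem3_general {H : Type*} [NormedAddCommGroup H] [InnerProductSpace ℂ H]
    [CompleteSpace H] {ι : Type*} {ρ : H →L[ℂ] H} (D : SpectralDecomposition ι ρ)
    {X Y : H →ₗ.[ℂ] H} (hX : IsSelfAdjoint X) (hY : IsSelfAdjoint Y) {c : ℂ}
    (hXY : ∀ x : (commutator X Y).domain, commutator X Y x = c • (x : H))
    (hD : ∀ k, D.eigenvector k ∈ (commutator X Y).domain) {α : ℝ} (hα : α ∈ Set.Icc (0 : ℝ) 1) :
    ENNReal.ofReal (1 / 4 * ‖traceWith D (commutator X Y) hD‖ ^ 2) ≤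
      skewW D α X (fun k => mem_domain_left (hD k)) *
        skewW D α Y (fun k => mem_domain_right (hD k)) := by
  have hXs := isFormalAdjoint_of_isSelfAdjoint hX
  have hYs := isFormalAdjoint_of_isSelfAdjoint hY
  obtain ⟨k₀, -⟩ := D.exists_eigenvalue_pos
  let d (k : ι) : ℝ := (⟪X ⟨_, mem_domain_left (hD k)⟩, Y ⟨_, mem_domain_right (hD k)⟩⟫_ℂ).im
  have hc (k : ι) : c = (2 * d k : ℝ) * Complex.I :=
    eq_two_mul_im_inner_mul_I hXs hYs (hD k) (hXY ⟨_, hD k⟩) (D.orthonormal.1 k)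
  have hd (k : ι) : d k = d k₀ := by simpa using (hc k).symm.trans (hc k₀)
  have htrace : 1 / 4 * ‖traceWith D (commutator X Y) hD‖ ^ 2 = d k₀ ^ 2 := by
    rw [traceWith_commutator D hXY hD, hc k₀, norm_mul, Complex.norm_I, Complex.norm_real, mul_one,
      Real.norm_eq_abs, sq_abs]
    ring
  rw [htrace]
  rcases eq_or_ne (d k₀) 0 with hzero | hne
  · simp [hzero]
  rcases or_assoc.2 (Set.eq_endpoints_or_mem_Ioo_of_mem_Icc hα) with hends | hIoo
  · have : Nontrivial H := ⟨_, 0, D.orthonormal.ne_zero k₀⟩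
    have hc0 : c ≠ 0 := by simpa [hc k₀] using hne
    rw [skewW_mul_skewW_eq_top D _ _ hends hX hY hd hne
      (not_domain_eq_top_of_commutator hXs hYs hc0 hXY)]
    exact le_top
  · exact sq_le_skewW_mul_skewW D _ _ hIoo hXs hX.dense_domain hYs hY.dense_domain hd

theorem mainTheorem3 {H : Type*} [NormedAddCommGroup H] [InnerProductSpace ℂ H] [CompleteSpace H]
    {ι : Type*} (ρ : H →L[ℂ] H) (D : SkewInformation.SpectralDecomposition ι ρ)
    (X Y : H →ₗ.[ℂ] H) (hX : IsSelfAdjoint X) (hY : IsSelfAdjoint Y)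
    (hXY : ∀ x : (SkewInformation.commutator X Y).domain,
      SkewInformation.commutator X Y x = (1 / (2 * (Real.pi : ℂ) * Complex.I)) • (x : H))
    (hD : ∀ k, D.eigenvector k ∈ (SkewInformation.commutator X Y).domain)
    (α : ℝ) (hα : α ∈ Set.Icc (0 : ℝ) 1) :
    ENNReal.ofReal
        (1 / 4 * ‖SkewInformation.traceWith D (SkewInformation.commutator X Y) hD‖ ^ 2) ≤
      SkewInformation.skewW D α X (fun k => SkewInformation.mem_domain_left (hD k)) *
        SkewInformation.skewW D α Y (fun k => SkewInformation.mem_domain_right (hD k)) :=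
  mainTheorem3_general D hX hY hXY hD hα
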